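/- Let $M$ be a Turing machine with states $Q_1,\dots,Q_N$ ($N\ge 1$), initial state $Q_1$, unique halt state $Q_N$, tape symbols $0,1$ (no blank), a tape that is infinite to the right only, and a transition function $d$ that assigns to every $(Q_i,b)$ with $i<N$ a triple (next state, symbol to write, direction L or R); there are no transitions from $Q_N$. On input $w\in\{0,1\}^*$ the machine starts in $Q_1$ on the leftmost cell, with $w$ on the first cells and $0$ on all others. It "outputs $w'$ after $t$ steps" if after exactly $t$ steps it is in state $Q_N$ and its tape holds $w'$ followed by zeros; it "crashes in step $t+1$" if after $t$ steps it is on the leftmost cell and is told to move left. Turing Tumble structure for $M$. Pieces: ramps; crossovers (a ball keeps its heading); gear bits (a ball finding value $0$ leaves to the right, one finding $1$ to the left, and the bit flips together with all gear bits on the same gear chain); triggers (order a ball from a hopper); interceptors (end a ball's motion). A ball only moves downwards; the next ball ordered is released when the previous one has been intercepted. From three (or two) linked gear bits one builds a non-destructive read ("ignore" if it does not branch), a write-0 and a write-1; in the branching form they let the ball leave to the left or right according to the value found. There are hoppers for 0-balls, 1-balls and query balls. - *State transition module.* Below the release of $b$-balls ($b=0,1$), rows $Q_1,\dots,Q_N$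 are read in this order. At the first $Q_i=1$ with $i<N$ the ball branches into column $(i,b)$, ignores the rows $Q_{i+1},\dots,Q_N$, and writes the rows $Q_N',\dots,Q_1'$: value $1$ at the state that $d(Q_i,b)$ leads to, $0$ at all others. For each $i$ all rows $Q_i,Q_i'$ in both halves are on one gear chain. Below $Q_N$ there is no branch but an interceptor. If $d(Q_i,b)=(Q_j,b',D)$, column $(i,b)$ is routed to line $Db'$. - *Bus and tape.* A bus of lines L0, L1, R0, R1, Q (query balls are released onto Q) runs down past 3-cells $1,2,3,\dots$, each with bits $h$, $S$, $p$; $p$ of each 3-cell but the first is on the gear chain of $h$ of the previous 3-cell. At the $h$ of each 3-cell, line Q reads $h$ and the other lines write-0 to $h$, branching into the 3-cell if $h$ was $1$ and otherwise continuing down the bus (ignoring $p$ rows they cross). In the 3-cell, the Q branch reads $S$, triggers a 0-ball or 1-ball according to its value, and is intercepted; the branches of L$b$ and R$b$ write $b$ to $S$; then L$b$ writes $1$ to $p$, triggers a query ball and is intercepted, while R$b$ writes $0$ to $p$, writes $1$ to $h$ of the next 3-cell, triggers a query ball and is intercepted. - *Set-up for $w$.* $Q_1=1$ and all other $Q_i=0$;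 $h=1$ in the first 3-cell only; the $S$ bits show $w$ followed by zeros; $p=0$ in the first 3-cell. The simulation starts by pressing the query trigger. It stops when no ball is moving and none is to be released. Call the board valid if $p=0$ in the first 3-cell and exactly one $h$ bit is $1$, and detectably invalid if $p=1$ in the first 3-cell and every $h$ bit is $0$. **Corollary.** The structure computes what $M$ computes: for all $w,w'$, the simulation on $w$ stops with its last ball in an interceptor below $Q_N$, the state rows showing $Q_N$ (i.e. $Q_N=1$ and all other $Q_i=0$) and the $S$ bits showing $w'$ followed by zeros, if and only if $M$ on $w$ outputs $w'$ after some number of steps. Moreover: 1. If $M$ on $w$ outputs $w'$ after $t$ steps, then just after the $2t$-th ball has been intercepted the state rows show $Q_N$, the $S$ bits show $w'$ followed by zeros, and the board is valid; the simulation stops after exactly two more balls, the last one in an interceptor below $Q_N$, and the board then still shows $Q_N$ and $w'$ and is valid. 2. If $M$ on $w$ runs forever, then the simulation never stops: for every $m$ an $m$-th ball is intercepted, and just after that $Q_N=0$, the last ball is not in an interceptor below $Q_N$, and the board is valid. 3. If $M$ on $w$ crashes in step $t+1$, then just after the $(2t+2)$-th ball has been intercepted the board is detectably invalid; the next ball falls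 past every level of the board and is never intercepted, so the simulation never stops; and no ball is ever intercepted below $Q_N$. -/

import Mathlib

/-! ### The Turing machines that are simulated -/

namespace TTumble

/-- A direction of motion; also the side of a piece, and the horizontal heading of a ball. -/
inductive Side
  | left
  | right
  deriving DecidableEq

/-- A Turing machine with `n + 1` states `Q_1, ..., Q_{n+1}` (here `0, ..., n`), tape symbols `0`
and `1` (`false` and `true`), and a head that moves left or right at every step. State `0` is
initial and the last state is the unique halt state: the transition function is defined exactly on
the other states, and `d i b = (j, b', D)` means: next state, symbol written, direction. -/
structure TM (n : ℕ) where
  d : Fin n → Bool → Fin (n + 1) × Bool × Side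

/-- A configuration of a machine with a one-way infinite tape, whose leftmost cell is cell `0`. -/
structure TMCfg (n : ℕ) where
  state : Fin (n + 1)
  head : ℕ
  tape : ℕ → Bool

/-- The tape holding the word `w` from the leftmost cell on, followed by zeros. -/
def wordTape (w : List Bool) : ℕ → Bool := fun k => w.getD k false

variable {n : ℕ}

namespace TM

/-- The instruction applicable in a configuration; none in the halt state. -/
def instr (M : TM n) (c : TMCfg n) : Option (Fin (n + 1) × Bool × Side) :=
  if h : c.state.val < n then some (M.d ⟨c.state.val, h⟩ (c.tape c.head)) else none

/-- One step of the machine. There is no next configuration in the halt state, and none if the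
head would move off the left edge of the tape. -/
def step (M : TM n) (c : TMCfg n) : Option (TMCfg n) :=
  match M.instr c with
  | none => none
  | some (j, b, Side.right) => some ⟨j, c.head + 1, Function.update c.tape c.head b⟩
  | some (j, b, Side.left) =>
    if c.head = 0 then none else some ⟨j, c.head - 1, Function.update c.tape c.head b⟩

/-- Initial configuration on `w`: initial state, head on the first cell, tape `w`. -/
def start (w : List Bool) : TMCfg n := ⟨0, 0, wordTape w⟩

/-- The configuration after `t` steps on input `w`, if the machine makes that many steps. -/
def run (M : TM n) (w : List Bool) : ℕ → Option (TMCfg n)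
  | 0 => some (start w)
  | t + 1 => (M.run w t).bind M.step

/-- On input `w` the machine runs for exactly `t` steps, is then in the halt state, and leaves the
output `w'` on its tape. -/
def HaltsIn (M : TM n) (w : List Bool) (t : ℕ) (w' : List Bool) : Prop :=
  ∃ c, M.run w t = some c ∧ c.state = Fin.last n ∧ c.tape = wordTape w'

/-- On input `w` the machine runs for exactly `t` steps without trouble, and the next instruction
tells it to move left from the leftmost cell. -/
def FallsOffAfter (M : TM n) (w : List Bool) (t : ℕ) : Prop :=
  ∃ c j b, M.run w t = some c ∧ c.head = 0 ∧ M.instr c = some (j, b, Side.left)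

/-- On input `w` the machine makes infinitely many steps. -/
def RunsForever (M : TM n) (w : List Bool) : Prop :=
  ∀ t, (M.run w t).isSome

end TM

/-! ### Turing Tumble: pieces, boards, and the motion of balls -/

/-- The pieces that balls meet. `χ` names the gear chains of a board and `η` its ball hoppers. A
gear bit carries the name of the chain it belongs to: gears themselves only serve to link the gear
bits of a chain, which therefore all show the same value. -/
inductive Piece (χ η : Type)
  | ramp (dir : Side)
  | crossover
  | gearBit (chain : χ)
  | trigger (hopper : η)
  | interceptor

/-- A Turing Tumble board, given by the places at which pieces sit and, for either lower side of a
place, the place to which a ball leaving on that side is led (directly, or by a chain of ramps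
which may use crossovers to cross other ramp chains); `none` if nothing is placed there. Balls only
move downwards. -/
structure Board (σ χ η : Type) where
  piece : σ → Piece χ η
  next : σ → Side → Option σ
  drop : η → σ
  depth : σ → ℕ
  falls : ∀ s d s', next s d = some s' → depth s < depth s'

/-- What is moving on the board: nothing, or a ball entering the piece at a given place with a given
heading (`right` if it comes from the upper left), or a ball that has left the pieces and falls
through the empty board. -/
inductive Motion (σ : Type)
  | idle
  | entering (s : σ) (heading : Side)
  | astray

/-- A snapshot of a board: the values of its gear chains (`false` = 0 = pointing left), the moving
ball, the triggered hoppers whose ball is still to be released, and the places of the interceptors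
that hold the balls intercepted so far, the latest first. -/
structure Snapshot (σ χ η : Type) where
  bits : χ → Bool
  motion : Motion σ
  pending : List η
  caught : List σ

namespace Board

variable {σ χ η : Type} [DecidableEq χ]

/-- The motion of a ball that leaves the place `s` on the side `d`. -/
def leave (B : Board σ χ η) (s : σ) (d : Side) : Motion σ :=
  match B.next s d with
  | some s' => Motion.entering s' d
  | none => Motion.astray

/-- The elementary step of a board. A ramp turns a ball to its own side; a crossover keeps the
heading; a gear bit flips, together with its whole chain, and sends the ball to the right if it
showed 0 and to the left if it showed 1; a trigger orders a ball from its hopper and lets the ball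
pass; an interceptor ends the motion of a ball. When no ball is moving, the next ball ordered is
released, and the board has stopped (`none`) if there is no such ball. A ball gone astray falls
forever. -/
def step (B : Board σ χ η) (c : Snapshot σ χ η) : Option (Snapshot σ χ η) :=
  match c.motion with
  | Motion.idle =>
    match c.pending with
    | [] => none
    | a :: l => some { c with motion := Motion.entering (B.drop a) Side.left, pending := l }
  | Motion.astray => some c
  | Motion.entering s d =>
    match B.piece s with
    | Piece.ramp e => some { c with motion := B.leave s e }
    | Piece.crossover => some { c with motion := B.leave s d }
    | Piece.gearBit x => some { c with
        bits := Function.update c.bits x (!c.bits x)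
        motion := B.leave s (if c.bits x then Side.left else Side.right) }
    | Piece.trigger a => some { c with motion := B.leave s d, pending := c.pending ++ [a] }
    | Piece.interceptor => some { c with motion := Motion.idle, caught := s :: c.caught }

end Board

/-! ### The useful components -/

/-- The non-destructive read (also used as "ignore"), and the two writes. -/
inductive Comp
  | read
  | write (b : Bool)

/-- The four places of a component: one gear bit at the top, a piece to the lower left of it, one to
the lower right, and the piece below where the two paths meet again. -/
inductive Slot
  | top
  | left
  | right
  | bottom

/-- The pieces of a component acting on the gear chain `x`. In a read, all of the upper three pieces
are gear bits of the chain. In a write-0, the left one is replaced by a ramp, so that only a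
ball that has found a 0 toggles the chain a second time; in a write-1 it is the right one. The
bottom piece is a crossover if the component is to branch (to the left if the chain showed
0, to the right if it showed 1), and just a ramp to the left if it is not. -/
def Comp.piece {χ η : Type} (k : Comp) (x : χ) (branching : Bool) : Slot → Piece χ η
  | Slot.top => Piece.gearBit x
  | Slot.left =>
    match k with
    | Comp.write false => Piece.ramp Side.right
    | _ => Piece.gearBit x
  | Slot.right =>
    match k with
    | Comp.write true => Piece.ramp Side.left
    | _ => Piece.gearBit x
  | Slot.bottom => if branching then Piece.crossover else Piece.ramp Side.left

/-! ### The structure simulating a Turing machine -/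

/-- The three hoppers, for 0-balls, 1-balls and query balls. -/
inductive Hopper
  | sym (b : Bool)
  | query
  deriving DecidableEq

/-- The rows of gear bits. `Q b i` and `Q' b i` are the row to be read and the row to be written for
the state `i`, in the half of the state transition module that lies below the `b`-ball release;
`h k`, `S k`, `p k` are the rows of the 3-cell number `k` (starting with `0`). -/
inductive Row (n : ℕ)
  | Q (b : Bool) (i : Fin (n + 1))
  | Q' (b : Bool) (i : Fin (n + 1))
  | h (k : ℕ)
  | S (k : ℕ)
  | p (k : ℕ)

/-- The gear chains. -/
inductive Chain (n : ℕ)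
  | state (i : Fin (n + 1))
  | head (k : ℕ)
  | symbol (k : ℕ)
  | edge
  deriving DecidableEq

/-- The gear chain that a row is part of: for every state, the rows `Q` and `Q'` in both halves of
the state transition module are connected in a cycle; the row `p` of every 3-cell is connected to
the row `h` of the previous one, except for the first 3-cell, whose row `p` is connected to
nothing. -/
def Row.chain : Row n → Chain n
  | Row.Q _ i => Chain.state i
  | Row.Q' _ i => Chain.state i
  | Row.h k => Chain.head k
  | Row.S k => Chain.symbol k
  | Row.p 0 => Chain.edge
  | Row.p (k + 1) => Chain.head k

/-- The five lines of the bus: `act D b` (called L0, L1, R0, R1) orders to write `b` and to move in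
the direction `D`. -/
inductive Line
  | act (D : Side) (b : Bool)
  | query

/-- The components of the structure.
* `test b i`: the read of `Q_i` in the half `b` of the state transition module.
* `pass b i k`: in the half `b`, the column for "`Q_i = 1`" crosses the row `Q_k` further below
  (those with `k ≤ i` are never led to).
* `write b i k`: further down, that column writes the row `Q'_k`.
* `busH k l`: the line `l` of the bus at the row `h` of the 3-cell `k`.
* `busP k l`: the line `l` of the bus crosses the row `p` of the 3-cell `k`
  (led to only where that row extends to the left across the bus).
* `cellS k l`: the line `l'` that has branched off into the 3-cell `k`, at its row `S`.
* `cellP k D b`: the line `l'`, for `l = act D b`, at the row `p` of the 3-cell `k`.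
* `nextH k b`: the line R0' or R1' of the 3-cell `k` at the row `h` of the 3-cell `k + 1`. -/
inductive Gadget (n : ℕ)
  | test (b : Bool) (i : Fin (n + 1))
  | pass (b : Bool) (i : Fin n) (k : Fin (n + 1))
  | write (b : Bool) (i : Fin n) (k : Fin (n + 1))
  | busH (k : ℕ) (l : Line)
  | busP (k : ℕ) (l : Line)
  | cellS (k : ℕ) (l : Line)
  | cellP (k : ℕ) (D : Side) (b : Bool)
  | nextH (k : ℕ) (b : Bool)

/-- The ends of the paths in the 3-cell `k`: below the `b`-side of the read of `S` on the query
line, and on the lines L0', L1', R0', R1'. At each of them there is a trigger, and below it an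
interceptor. -/
inductive PathEnd
  | sym (k : ℕ) (b : Bool)
  | act (k : ℕ) (D : Side) (b : Bool)

/-- All places of the board. `halt b` is the interceptor immediately below the last state row in the
half `b` of the state transition module. -/
inductive Site (n : ℕ)
  | part (g : Gadget n) (s : Slot)
  | trig (e : PathEnd)
  | catcher (e : PathEnd)
  | halt (b : Bool)

/-- The row of gear bits that a component acts on. -/
def Gadget.row : Gadget n → Row n
  | Gadget.test b i => Row.Q b i
  | Gadget.pass b _ k => Row.Q b k
  | Gadget.write b _ k => Row.Q' b k
  | Gadget.busH k _ => Row.h k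
  | Gadget.busP k _ => Row.p k
  | Gadget.cellS k _ => Row.S k
  | Gadget.cellP k _ _ => Row.p k
  | Gadget.nextH k _ => Row.h (k + 1)

/-- The type of each component. The column for the state `i` below the `b`-ball release writes 1 to
the state `d i b` leads to, and 0 to all others. -/
def Gadget.comp (M : TM n) : Gadget n → Comp
  | Gadget.test _ _ => Comp.read
  | Gadget.pass _ _ _ => Comp.read
  | Gadget.write b i k => Comp.write (decide (k = (M.d i b).1))
  | Gadget.busH _ (Line.act _ _) => Comp.write false
  | Gadget.busH _ Line.query => Comp.read
  | Gadget.busP _ _ => Comp.read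
  | Gadget.cellS _ (Line.act _ b) => Comp.write b
  | Gadget.cellS _ Line.query => Comp.read
  | Gadget.cellP _ Side.left _ => Comp.write true
  | Gadget.cellP _ Side.right _ => Comp.write false
  | Gadget.nextH _ _ => Comp.write true

/-- Which components branch. There is no branch at the halt state. -/
def Gadget.branching : Gadget n → Bool
  | Gadget.test _ i => decide (i.val < n)
  | Gadget.busH _ _ => true
  | Gadget.cellS _ Line.query => true
  | _ => false

/-- The row `p` of the 3-cell `k` extends to the left across the bus if it is the third, fifth,
seventh, ... one; those of the even numbered 3-cells (`k` odd) extend to the right. -/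
def crossesBus (k : ℕ) : Bool := decide (k ≠ 0 ∧ k % 2 = 0)

/-- Where the paths leaving a component lead (on either side if it does not branch). -/
def Gadget.out (M : TM n) : Gadget n → Side → Site n
  | Gadget.test b i, s =>
    if h : i.val < n then
      match s with
      | Side.left => Site.part (Gadget.test b ⟨i.val + 1, by omega⟩) Slot.top
      | Side.right => Site.part (Gadget.pass b ⟨i.val, h⟩ ⟨i.val + 1, by omega⟩) Slot.top
    else Site.halt b
  | Gadget.pass b i k, _ =>
    if h : k.val < n then Site.part (Gadget.pass b i ⟨k.val + 1, by omega⟩) Slot.top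
    else Site.part (Gadget.write b i (Fin.last n)) Slot.top
  | Gadget.write b i k, _ =>
    if k.val = 0 then Site.part (Gadget.busH 0 (Line.act (M.d i b).2.2 (M.d i b).2.1)) Slot.top
    else Site.part (Gadget.write b i ⟨k.val - 1, by omega⟩) Slot.top
  | Gadget.busH k l, Side.left =>
    if crossesBus k then Site.part (Gadget.busP k l) Slot.top
    else Site.part (Gadget.busH (k + 1) l) Slot.top
  | Gadget.busH k l, Side.right => Site.part (Gadget.cellS k l) Slot.top
  | Gadget.busP k l, _ => Site.part (Gadget.busH (k + 1) l) Slot.top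
  | Gadget.cellS k (Line.act D b), _ => Site.part (Gadget.cellP k D b) Slot.top
  | Gadget.cellS k Line.query, Side.left => Site.trig (PathEnd.sym k false)
  | Gadget.cellS k Line.query, Side.right => Site.trig (PathEnd.sym k true)
  | Gadget.cellP k Side.left b, _ => Site.trig (PathEnd.act k Side.left b)
  | Gadget.cellP k Side.right b, _ => Site.part (Gadget.nextH k b) Slot.top
  | Gadget.nextH k b, _ => Site.trig (PathEnd.act k Side.right b)

/-- The hopper that is triggered at the end of a path. -/
def PathEnd.hopper : PathEnd → Hopper
  | PathEnd.sym _ b => Hopper.sym b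
  | PathEnd.act _ _ _ => Hopper.query

/-- The pieces of the board. -/
def Site.piece (M : TM n) : Site n → Piece (Chain n) Hopper
  | Site.part g s => (g.comp M).piece g.row.chain g.branching s
  | Site.trig e => Piece.trigger e.hopper
  | Site.catcher _ => Piece.interceptor
  | Site.halt _ => Piece.interceptor

/-- The connections of the board. -/
def Site.next (M : TM n) : Site n → Side → Option (Site n)
  | Site.part g Slot.top, Side.left => some (Site.part g Slot.left)
  | Site.part g Slot.top, Side.right => some (Site.part g Slot.right)
  | Site.part g Slot.left, Side.right => some (Site.part g Slot.bottom)
  | Site.part _ Slot.left, Side.left => none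
  | Site.part g Slot.right, Side.left => some (Site.part g Slot.bottom)
  | Site.part _ Slot.right, Side.right => none
  | Site.part g Slot.bottom, s => some (g.out M s)
  | Site.trig e, _ => some (Site.catcher e)
  | Site.catcher _, _ => none
  | Site.halt _, _ => none

/-- Where a ball released from a hopper starts: the 0-balls and 1-balls above the respective half of
the state transition module, the query balls on the query line of the bus. -/
def Hopper.drop : Hopper → Site n
  | Hopper.sym b => Site.part (Gadget.test b 0) Slot.top
  | Hopper.query => Site.part (Gadget.busH 0 Line.query) Slot.top

/-- A vertical position for each component. -/
def Gadget.level : Gadget n → ℕ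
  | Gadget.test _ i => 10 * i.val
  | Gadget.pass _ _ k => 10 * k.val
  | Gadget.write _ _ k => 10 * (n + 1) + 10 * (n - k.val)
  | Gadget.busH k _ => 20 * (n + 1) + 40 * k
  | Gadget.cellS k _ => 20 * (n + 1) + 40 * k + 10
  | Gadget.busP k _ => 20 * (n + 1) + 40 * k + 20
  | Gadget.cellP k _ _ => 20 * (n + 1) + 40 * k + 20
  | Gadget.nextH k _ => 20 * (n + 1) + 40 * (k + 1)

/-- A vertical position for each place. -/
def Site.level : Site n → ℕ
  | Site.part g Slot.top => g.level
  | Site.part g Slot.left => g.level + 1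
  | Site.part g Slot.right => g.level + 1
  | Site.part g Slot.bottom => g.level + 2
  | Site.trig (PathEnd.sym k _) => 20 * (n + 1) + 40 * k + 13
  | Site.trig (PathEnd.act k Side.left _) => 20 * (n + 1) + 40 * k + 23
  | Site.trig (PathEnd.act k Side.right _) => 20 * (n + 1) + 40 * (k + 1) + 3
  | Site.catcher (PathEnd.sym k _) => 20 * (n + 1) + 40 * k + 14
  | Site.catcher (PathEnd.act k Side.left _) => 20 * (n + 1) + 40 * k + 24
  | Site.catcher (PathEnd.act k Side.right _) => 20 * (n + 1) + 40 * (k + 1) + 4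
  | Site.halt _ => 10 * n + 3

theorem Gadget.level_out (M : TM n) (g : Gadget n) (s : Side) :
    g.level + 2 < (g.out M s).level := by
  cases g with
  | test b i =>
    rcases s <;> simp only [Gadget.out] <;> split <;> simp only [Site.level, Gadget.level] <;> omega
  | pass b i k =>
    simp only [Gadget.out]
    split <;> simp only [Site.level, Gadget.level, Fin.val_last] <;> omega
  | write b i k =>
    simp only [Gadget.out]
    split <;> simp only [Site.level, Gadget.level] <;> omega
  | busH k l =>
    rcases s <;> simp only [Gadget.out] <;> (try split) <;>
      simp only [Site.level, Gadget.level] <;> omega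
  | busP k l => simp only [Gadget.out, Site.level, Gadget.level]; omega
  | cellS k l =>
    rcases l <;> rcases s <;> simp only [Gadget.out, Site.level, Gadget.level] <;> omega
  | cellP k D b =>
    rcases D <;> simp only [Gadget.out, Site.level, Gadget.level] <;> omega
  | nextH k b => simp only [Gadget.out, Site.level, Gadget.level]; omega

theorem Site.level_next (M : TM n) (s : Site n) (d : Side) (s' : Site n)
    (h : s.next M d = some s') : s.level < s'.level := by
  rcases s with ⟨g, t⟩ | e | e | b
  · rcases t <;> rcases d <;> simp only [Site.next, Option.some.injEq, reduceCtorEq] at h <;>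
      subst h <;> first
        | (simp only [Site.level]; omega)
        | (have := g.level_out M Side.left; simpa only [Site.level] using this)
        | (have := g.level_out M Side.right; simpa only [Site.level] using this)
  · simp only [Site.next, Option.some.injEq] at h
    subst h
    rcases e with ⟨k, b⟩ | ⟨k, D, b⟩
    · simp only [Site.level]; omega
    · rcases D <;> simp only [Site.level] <;> omega
  · simp [Site.next] at h
  · simp [Site.next] at h

/-- The board built for the machine `M`. -/
def TM.board (M : TM n) : Board (Site n) (Chain n) Hopper where
  piece := Site.piece M
  next := Site.next M
  drop := Hopper.drop
  depth := Site.level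
  falls := Site.level_next M

/-- The set-up for the input `w`: the initial state bit is 1 and the other state bits are 0, the
symbols of `w` are in the first 3-cells and all other symbols are 0, the head is at the first
3-cell. -/
def initBits (w : List Bool) : Chain n → Bool
  | Chain.state i => decide (i = 0)
  | Chain.head k => decide (k = 0)
  | Chain.symbol k => wordTape w k
  | Chain.edge => false

/-- A snapshot of the board built for a machine with `n + 1` states. -/
abbrev Snap (n : ℕ) := Snapshot (Site n) (Chain n) Hopper

/-- The simulation starts with a press of the query trigger. -/
def initSnap (w : List Bool) : Snap n :=
  ⟨initBits w, Motion.idle, [Hopper.query], []⟩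

/-- The snapshot `c` occurs in the simulation of `M` on input `w`. -/
def Occurs (M : TM n) (w : List Bool) (c : Snap n) : Prop :=
  StateTransition.Reaches M.board.step (initSnap w) c

/-- The snapshot `c` occurs in the simulation just after the `m`-th ball has been intercepted
(for `m = 0`: before the first ball is released). -/
def AfterBalls (M : TM n) (w : List Bool) (m : ℕ) (c : Snap n) : Prop :=
  Occurs M w c ∧ c.motion = Motion.idle ∧ c.caught.length = m

/-- The simulation stops in the snapshot `c`: nothing is moving, and no ball is to be released. -/
def StopsWith (M : TM n) (w : List Bool) (c : Snap n) : Prop :=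
  c ∈ StateTransition.eval M.board.step (initSnap w)

namespace Snapshot

/-- The value that a row of gear bits shows. -/
def shows (c : Snap n) (r : Row n) : Bool := c.bits r.chain

/-- The state transition module shows that the state is `i`. -/
def ShowsState (c : Snap n) (i : Fin (n + 1)) : Prop :=
  ∀ b j, c.shows (Row.Q b j) = decide (j = i)

/-- The `S` bits show the word `w`, followed by zeros. -/
def ShowsWord (c : Snap n) (w : List Bool) : Prop :=
  ∀ k, c.shows (Row.S k) = wordTape w k

/-- The latest ball intercepted is in an interceptor below the halt state. -/
def HaltBall (c : Snap n) : Prop :=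
  ∃ b l, c.caught = Site.halt b :: l

/-- Detectably invalid: the `p` bit of the first 3-cell is set, and there is no `h` bit set. -/
def Invalid (c : Snap n) : Prop :=
  c.shows (Row.p 0) = true ∧ ∀ k, c.shows (Row.h k) = false

/-- The `p` bit of the first 3-cell is not set, and exactly one `h` bit is set. -/
def Valid (c : Snap n) : Prop :=
  c.shows (Row.p 0) = false ∧ ∃! k, c.shows (Row.h k) = true

end Snapshot

end TTumble

/-!
The board never has more than one ball moving, and what a ball does depends only on the
values of the gear chains. A ball meets one component after the other; `Gadget.reaches₁_out` works
out once and for all what a component does to its gear chain and on which side the ball leaves it,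
and `Leads` composes such passages.

Between balls, the gear chains display a configuration of the machine (`TMCfg.bits`). A query ball
changes none of them, since it only reads, and it orders a ball for the symbol under the head
(`leads_query`). If the state is not the halt state, that ball leaves the state rows at the present
state, sets the state bits (`leads_write`), runs down the bus to the only `h` bit that is set,
erases it, writes the symbol there, and sets the `h` bit of a neighbouring 3-cell; so the chains
then display the next configuration (`leads_step`). Hence two balls are intercepted for every step
of the machine (`exists_occurs`). In the halt state the ball ends in an interceptor and nothing
is ordered (`exists_stopsWith`). A move off the left edge sets the `p` bit of the first 3-cell and
leaves all `h` bits at 0, so that the next query ball falls past every 3-cell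
(`exists_occurs_of_fallsOffAfter`).

The claims about all snapshots, rather than about those just found, hold because the board is
deterministic: the snapshot after the `m`-th interception is unique (`AfterBalls.eq`), and a run
with infinitely many different snapshots does not stop (`notMem_eval_of_injective`).
-/

namespace TTumble

open StateTransition

variable {n : ℕ}

/-! ### Passing a component -/

/-- The value that a gear chain shows after a component has acted on it, in terms of the value
found. -/
def Comp.eff : Comp → Bool → Bool
  | Comp.read, v => v
  | Comp.write b, _ => b

/-- The side on which a ball that has found the value `v` leaves a component. -/
def Gadget.exit (g : Gadget n) (v : Bool) : Side :=
  if g.branching && v then Side.right else Side.left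

theorem Gadget.reaches₁_out (M : TM n) (g : Gadget n) (f : Chain n → Bool) (d : Side)
    (P : List Hopper) (C : List (Site n)) :
    Reaches₁ M.board.step ⟨f, Motion.entering (Site.part g Slot.top) d, P, C⟩
      ⟨Function.update f g.row.chain ((g.comp M).eff (f g.row.chain)),
        Motion.entering (g.out M (g.exit (f g.row.chain))) (g.exit (f g.row.chain)), P, C⟩ := by
  -- the ball visits the top, one of the sides, and the bottom of the component
  refine .head (b := ⟨Function.update f g.row.chain (!f g.row.chain),
    cond (f g.row.chain) (.entering (Site.part g Slot.left) Side.left)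
      (.entering (Site.part g Slot.right) Side.right), P, C⟩) ?_ <|
    .head (b := ⟨Function.update f g.row.chain ((g.comp M).eff (f g.row.chain)),
      .entering (Site.part g Slot.bottom) (cond (f g.row.chain) Side.right Side.left), P, C⟩) ?_ <|
    .single ?_
  · cases hv : f g.row.chain <;>
      simp [Board.step, TM.board, Site.piece, Comp.piece, Board.leave, Site.next, hv]
  · cases hv : f g.row.chain <;> rcases hk : g.comp M with _ | (_ | _) <;>
      simp [Board.step, TM.board, Site.piece, Comp.piece, Board.leave, Site.next, hk, Comp.eff]
  · cases hv : f g.row.chain <;> cases hb : g.branching <;>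
      simp [Board.step, TM.board, Site.piece, Comp.piece, Board.leave, Site.next, hb, Gadget.exit]

/-! ### Chains of components -/

/-- A ball entering the place `s` while the gear chains show `f` is led to the place `s'`, which it
enters while they show `f'`; nothing is ordered or intercepted on the way. The headings are left
open, since no component depends on the heading of a ball that enters at its top. -/
def Leads (M : TM n) (f : Chain n → Bool) (s : Site n) (f' : Chain n → Bool) (s' : Site n) : Prop :=
  ∀ d P C, ∃ d', Reaches M.board.step ⟨f, Motion.entering s d, P, C⟩
    ⟨f', Motion.entering s' d', P, C⟩

section

variable {M : TM n} {f f' f'' : Chain n → Bool} {s s' s'' : Site n}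

theorem Leads.refl : Leads M f s f s := fun d _ _ => ⟨d, .refl⟩

theorem Leads.trans (h : Leads M f s f' s') (h' : Leads M f' s' f'' s'') :
    Leads M f s f'' s'' := fun d P C =>
  let ⟨d', hd'⟩ := h d P C
  let ⟨d'', hd''⟩ := h' d' P C
  ⟨d'', hd'.trans hd''⟩

theorem leads_out {g : Gadget n} (v : Bool) (hv : f g.row.chain = v)
    (hf : Function.update f g.row.chain ((g.comp M).eff v) = f') (hs : g.out M (g.exit v) = s') :
    Leads M f (Site.part g Slot.top) f' s' := by
  subst hv hf hs
  exact fun d P C => ⟨_, (g.reaches₁_out M f d P C).to_reflTransGen⟩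

/-- A read leaves the gear chains alone, and so does a write of the value already shown. -/
theorem leads_out_of_eff {g : Gadget n} (v : Bool) (hv : f g.row.chain = v)
    (he : (g.comp M).eff v = v) (hs : g.out M (g.exit v) = s') :
    Leads M f (Site.part g Slot.top) f s' :=
  leads_out v hv (by rw [he, ← hv, Function.update_eq_self]) hs

end

/-! ### The state transition module -/

theorem leads_test {M : TM n} {f : Chain n → Bool} (b : Bool) {q : ℕ} (hq : q < n + 1)
    (h : ∀ i : Fin (n + 1), i.val < q → f (Chain.state i) = false) :
    Leads M f (Site.part (Gadget.test b 0) Slot.top)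
      f (Site.part (Gadget.test b ⟨q, hq⟩) Slot.top) := by
  induction q with
  | zero => exact .refl
  | succ q ih =>
    refine (ih (by omega) fun i hi => h i (by omega)).trans <|
      leads_out_of_eff false (h ⟨q, by omega⟩ (by simp)) rfl ?_
    have : q < n := by omega
    simp [Gadget.out, Gadget.exit, this]

theorem leads_pass {M : TM n} {f : Chain n → Bool} (b : Bool) (i : Fin n) (k : ℕ) (hk : k < n + 1) :
    Leads M f (Site.part (Gadget.pass b i ⟨k, hk⟩) Slot.top)
      f (Site.part (Gadget.write b i (Fin.last n)) Slot.top) := by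
  by_cases h : k < n
  · exact (leads_out_of_eff _ rfl rfl (by simp [Gadget.out, h])).trans
      (leads_pass b i (k + 1) (by omega))
  · exact leads_out_of_eff _ rfl rfl (by simp [Gadget.out, h])
termination_by n - k

/-- The column `(i, b)`, from the row `Q'_k` on, sets the bits of the states up to `k`. -/
theorem leads_write {M : TM n} (b : Bool) (i : Fin n) (k : ℕ) (hk : k < n + 1)
    {f f' : Chain n → Bool}
    (hle : ∀ j : Fin (n + 1), j.val ≤ k → f' (Chain.state j) = decide (j = (M.d i b).1))
    (hne : ∀ x, (∀ j : Fin (n + 1), j.val ≤ k → x ≠ Chain.state j) → f' x = f x) :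
    Leads M f (Site.part (Gadget.write b i ⟨k, hk⟩) Slot.top)
      f' (Site.part (Gadget.busH 0 (Line.act (M.d i b).2.2 (M.d i b).2.1)) Slot.top) := by
  induction k generalizing f with
  | zero =>
    refine leads_out _ rfl ?_ (by simp [Gadget.out])
    funext x
    change Function.update f (Chain.state ⟨0, hk⟩) (decide ((⟨0, hk⟩ : Fin (n + 1)) = _)) x = _
    rw [Function.update_apply]
    split_ifs with hx
    · rw [hx, hle _ le_rfl]
    · refine (hne x fun j hj h => hx ?_).symm
      obtain rfl : j = ⟨0, hk⟩ := Fin.ext (Nat.le_zero.mp hj)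
      exact h
  | succ k ih =>
    refine (leads_out (s' := Site.part (Gadget.write b i ⟨k, by omega⟩) Slot.top) _ rfl rfl
      (by simp [Gadget.out])).trans
      (ih (by omega) (fun j hj => hle j (by omega)) fun x hx => ?_)
    change _ = Function.update f (Chain.state ⟨k + 1, hk⟩)
      (decide ((⟨k + 1, hk⟩ : Fin (n + 1)) = _)) x
    rw [Function.update_apply]
    split_ifs with hx'
    · rw [hx', hle _ le_rfl]
    · refine hne x fun j hj h => ?_
      rcases hj.eq_or_lt with hj | hj
      · obtain rfl : j = ⟨k + 1, hk⟩ := Fin.ext hj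
        exact hx' h
      · exact hx j (by omega) h

/-! ### The bus -/

/-- A ball on the bus runs past 3-cells whose `h` bit is 0. -/
theorem leads_bus {M : TM n} {f : Chain n → Bool} (l : Line) {k : ℕ}
    (h : ∀ j < k, f (Chain.head j) = false) :
    Leads M f (Site.part (Gadget.busH 0 l) Slot.top)
      f (Site.part (Gadget.busH k l) Slot.top) := by
  induction k with
  | zero => exact .refl
  | succ k ih =>
    have he : ((Gadget.busH k l : Gadget n).comp M).eff false = false := by cases l <;> rfl
    refine (ih fun j hj => h j (by omega)).trans ?_
    by_cases hc : crossesBus k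
    · exact (leads_out_of_eff false (h k (by omega)) he
        (by simp [Gadget.out, Gadget.exit, hc]; rfl)).trans (leads_out_of_eff _ rfl rfl rfl)
    · exact leads_out_of_eff false (h k (by omega)) he (by simp [Gadget.out, Gadget.exit, hc])

/-! ### Balls carrying out a step of the machine -/

/-- The gear chains showing a configuration: the state, the head position and the tape are
displayed by the state bits, the `h` bits and the `S` bits, and the first `p` bit is 0. -/
def TMCfg.bits (c : TMCfg n) : Chain n → Bool
  | Chain.state i => decide (i = c.state)
  | Chain.head k => decide (k = c.head)
  | Chain.symbol k => c.tape k
  | Chain.edge => false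

/-- The gear chains after the machine has been told to move off the left edge of the tape. -/
def crashBits (q : Fin (n + 1)) (T : ℕ → Bool) : Chain n → Bool
  | Chain.state i => decide (i = q)
  | Chain.head _ => false
  | Chain.symbol k => T k
  | Chain.edge => true

theorem leads_query (M : TM n) (c : TMCfg n) :
    Leads M c.bits (Hopper.drop Hopper.query)
      c.bits (Site.trig (PathEnd.sym c.head (c.tape c.head))) := by
  refine (leads_bus Line.query (k := c.head) fun j hj => ?_).trans <|
    (leads_out_of_eff true ?_ rfl rfl).trans <|
    leads_out_of_eff (c.tape c.head) rfl rfl ?_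
  · simpa [TMCfg.bits] using hj.ne
  · simp [TMCfg.bits, Gadget.row, Row.chain]
  · cases c.tape c.head <;> rfl

theorem leads_test_state (M : TM n) (c : TMCfg n) (b : Bool) :
    Leads M c.bits (Hopper.drop (Hopper.sym b))
      c.bits (Site.part (Gadget.test b c.state) Slot.top) :=
  leads_test b c.state.isLt fun i hi => by
    simpa [TMCfg.bits] using fun h : i = c.state => hi.ne (congrArg _ h)

theorem leads_halt (M : TM n) (c : TMCfg n) (b : Bool) (h : c.state = Fin.last n) :
    Leads M c.bits (Hopper.drop (Hopper.sym b)) c.bits (Site.halt b) :=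
  (leads_test_state M c b).trans (leads_out_of_eff _ rfl rfl (by simp [Gadget.out, h]))

/-- A ball released for the symbol `b` updates the state, and is then put on the line of the bus
that carries the rest of the instruction. -/
theorem leads_column {M : TM n} {c : TMCfg n} {b b' : Bool} {i : Fin n} {j : Fin (n + 1)} {D : Side}
    (hi : c.state = i.castSucc) (hd : M.d i b = (j, b', D)) :
    Leads M c.bits (Hopper.drop (Hopper.sym b)) (TMCfg.bits { c with state := j })
      (Site.part (Gadget.busH 0 (Line.act D b')) Slot.top) := by
  have hw := leads_write (M := M) b i n n.lt_succ_self (f := c.bits)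
    (f' := TMCfg.bits { c with state := j })
    (fun k _ => by simp [TMCfg.bits, hd])
    (fun x hx => by cases x <;> first | rfl | exact absurd rfl (hx _ (by omega)))
  rw [hd] at hw
  refine (leads_test_state M c b).trans <|
    (leads_out_of_eff true (by simp [TMCfg.bits, Gadget.row, Row.chain]) rfl ?_).trans <|
    (leads_pass b i (i.val + 1) (by omega)).trans hw
  simp [Gadget.out, Gadget.exit, Gadget.branching, hi]

/-- On the bus, the ball erases the `h` bit it finds set, and writes the symbol. -/
theorem leads_cell (M : TM n) (c : TMCfg n) (D : Side) (b : Bool) :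
    Leads M c.bits (Site.part (Gadget.busH 0 (Line.act D b)) Slot.top)
      (Function.update (Function.update c.bits (Chain.head c.head) false) (Chain.symbol c.head) b)
      (Site.part (Gadget.cellP c.head D b) Slot.top) := by
  refine (leads_bus _ (k := c.head) fun j hj => ?_).trans <|
    (leads_out true ?_ rfl rfl).trans (leads_out _ rfl rfl rfl)
  · simpa [TMCfg.bits] using hj.ne
  · simp [TMCfg.bits, Gadget.row, Row.chain]

theorem leads_right (M : TM n) (c : TMCfg n) (b : Bool) :
    Leads M c.bits (Site.part (Gadget.busH 0 (Line.act Side.right b)) Slot.top)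
      (TMCfg.bits ⟨c.state, c.head + 1, Function.update c.tape c.head b⟩)
      (Site.trig (PathEnd.act c.head Side.right b)) := by
  refine (leads_cell M c _ b).trans <| (leads_out _ rfl rfl rfl).trans <|
    leads_out _ rfl ?_ rfl
  funext x
  rcases c with ⟨q, k, T⟩
  rcases x with i | j | j | _ <;> rcases k with _ | k <;>
    simp [Gadget.row, Row.chain, Gadget.comp, Comp.eff, TMCfg.bits, Function.update_apply]

theorem leads_left (M : TM n) (c : TMCfg n) (b : Bool) (h : c.head ≠ 0) :
    Leads M c.bits (Site.part (Gadget.busH 0 (Line.act Side.left b)) Slot.top)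
      (TMCfg.bits ⟨c.state, c.head - 1, Function.update c.tape c.head b⟩)
      (Site.trig (PathEnd.act c.head Side.left b)) := by
  refine (leads_cell M c _ b).trans <| leads_out _ rfl ?_ rfl
  funext x
  rcases c with ⟨q, _ | k, T⟩
  · exact absurd rfl h
  · rcases x with i | j | j | _ <;>
      simp [Gadget.row, Row.chain, Gadget.comp, Comp.eff, TMCfg.bits, Function.update_apply]

theorem leads_crash (M : TM n) (c : TMCfg n) (b : Bool) (h : c.head = 0) :
    Leads M c.bits (Site.part (Gadget.busH 0 (Line.act Side.left b)) Slot.top)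
      (crashBits c.state (Function.update c.tape c.head b))
      (Site.trig (PathEnd.act c.head Side.left b)) := by
  refine (leads_cell M c _ b).trans <| leads_out _ rfl ?_ rfl
  funext x
  rcases c with ⟨q, k, T⟩
  obtain rfl : k = 0 := h
  rcases x with i | j | j | _ <;>
    simp [Gadget.row, Row.chain, Gadget.comp, Comp.eff, TMCfg.bits, crashBits,
      Function.update_apply]

/-! ### Runs of the machine -/

theorem TM.instr_eq_some {M : TM n} {c : TMCfg n} {r : Fin (n + 1) × Bool × Side}
    (h : M.instr c = some r) : ∃ i : Fin n, c.state = i.castSucc ∧ M.d i (c.tape c.head) = r := by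
  unfold TM.instr at h
  split at h
  · exact ⟨_, rfl, Option.some.inj h⟩
  · cases h

theorem TM.instr_eq_none {M : TM n} {c : TMCfg n} : M.instr c = none ↔ c.state = Fin.last n := by
  have := c.state.isLt
  simp only [TM.instr, Fin.ext_iff, Fin.val_last, dite_eq_right_iff, reduceCtorEq, imp_false]
  omega

theorem TM.step_of_state {M : TM n} {c : TMCfg n} (h : c.state = Fin.last n) : M.step c = none := by
  simp [TM.step, TM.instr_eq_none.mpr h]

theorem TM.step_eq_none {M : TM n} {c : TMCfg n} (h : M.step c = none) :
    c.state = Fin.last n ∨ c.head = 0 ∧ ∃ j b, M.instr c = some (j, b, Side.left) := by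
  rcases hi : M.instr c with _ | ⟨j, b, _ | _⟩
  · exact .inl (TM.instr_eq_none.mp hi)
  · exact .inr ⟨by simpa [TM.step, hi] using h, j, b, rfl⟩
  · simp [TM.step, hi] at h

theorem TM.runsForever_or (M : TM n) (w : List Bool) :
    M.RunsForever w ∨ (∃ t c, M.run w t = some c ∧ c.state = Fin.last n) ∨
      ∃ t, M.FallsOffAfter w t := by
  refine or_iff_not_imp_left.mpr fun h => ?_
  obtain ⟨t, c, ht, hc⟩ : ∃ t c, M.run w t = some c ∧ M.step c = none := by
    by_contra! hs
    refine h fun t => ?_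
    induction t with
    | zero => rfl
    | succ t ih =>
      obtain ⟨c, hc⟩ := Option.isSome_iff_exists.mp ih
      simpa [TM.run, hc, Option.isSome_iff_ne_none] using hs t c hc
  rcases TM.step_eq_none hc with hc | ⟨h0, j, b, hi⟩
  · exact .inl ⟨t, c, ht, hc⟩
  · exact .inr ⟨t, c, j, b, ht, h0, hi⟩

/-- The ball released for the symbol under the head carries out a step of the machine. -/
theorem leads_step {M : TM n} {c c' : TMCfg n} (h : M.step c = some c') :
    ∃ e : PathEnd, e.hopper = Hopper.query ∧
      Leads M c.bits (Hopper.drop (Hopper.sym (c.tape c.head))) c'.bits (Site.trig e) := by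
  rcases hi : M.instr c with _ | ⟨j, b, _ | _⟩
  · simp [TM.step, hi] at h
  · obtain ⟨h0, rfl⟩ : c.head ≠ 0 ∧ _ = c' := by simpa [TM.step, hi] using h
    obtain ⟨i, hs, hd⟩ := TM.instr_eq_some hi
    exact ⟨_, rfl, (leads_column hs hd).trans (leads_left M { c with state := j } b h0)⟩
  · obtain rfl : _ = c' := by simpa [TM.step, hi] using h
    obtain ⟨i, hs, hd⟩ := TM.instr_eq_some hi
    exact ⟨_, rfl, (leads_column hs hd).trans (leads_right M { c with state := j } b)⟩

/-! ### From one interception to the next -/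

section

variable {M : TM n} {f f' : Chain n → Bool} {a : Hopper} {C : List (Site n)}

theorem Leads.reaches_entering {s : Site n} (h : Leads M f a.drop f' s) (P : List Hopper) :
    ∃ d, Reaches M.board.step ⟨f, Motion.idle, a :: P, C⟩ ⟨f', Motion.entering s d, P, C⟩ :=
  let ⟨d, hd⟩ := h Side.left P C
  ⟨d, .head rfl hd⟩

theorem Leads.reaches_trig {e : PathEnd} (h : Leads M f a.drop f' (Site.trig e)) :
    Reaches M.board.step ⟨f, Motion.idle, [a], C⟩
      ⟨f', Motion.idle, [e.hopper], Site.catcher e :: C⟩ :=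
  let ⟨_, hd⟩ := h.reaches_entering []
  hd.trans (.head rfl (.single rfl))

theorem Leads.reaches_halt {b : Bool} (h : Leads M f a.drop f' (Site.halt b)) :
    Reaches M.board.step ⟨f, Motion.idle, [a], C⟩ ⟨f', Motion.idle, [], Site.halt b :: C⟩ :=
  let ⟨_, hd⟩ := h.reaches_entering []
  hd.trans (.single rfl)

end

/-- A query ball finds the symbol under the head, and orders a ball for it. -/
theorem reaches_query (M : TM n) (c : TMCfg n) (C : List (Site n)) :
    Reaches M.board.step ⟨c.bits, Motion.idle, [Hopper.query], C⟩
      ⟨c.bits, Motion.idle, [Hopper.sym (c.tape c.head)],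
        Site.catcher (PathEnd.sym c.head (c.tape c.head)) :: C⟩ :=
  (leads_query M c).reaches_trig

/-- Two balls are intercepted for every step of the machine, none of them below the halt state. -/
theorem exists_occurs {M : TM n} {w : List Bool} {t : ℕ} {c : TMCfg n} (h : M.run w t = some c) :
    ∃ C : List (Site n), C.length = 2 * t ∧ (∀ b, Site.halt b ∉ C) ∧
      Occurs M w ⟨c.bits, Motion.idle, [Hopper.query], C⟩ := by
  induction t generalizing c with
  | zero =>
    obtain rfl : _ = c := Option.some.inj h
    refine ⟨[], rfl, by simp, ?_⟩
    have : (TM.start w : TMCfg n).bits = initBits w := by funext x; cases x <;> rfl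
    rw [this]
    exact .refl
  | succ t ih =>
    obtain ⟨c₀, h₀, hs⟩ := Option.bind_eq_some_iff.mp h
    obtain ⟨C, hl, hn, ho⟩ := ih h₀
    obtain ⟨e, he, hp⟩ := leads_step hs
    refine ⟨_, ?_, ?_, he ▸ (ho.trans (reaches_query M c₀ C)).trans hp.reaches_trig⟩
    · simp [hl]; ring
    · simpa using hn

/-! ### Snapshots that occur -/

theorem caught_suffix_of_step {M : TM n} {x y : Snap n} (h : y ∈ M.board.step x) :
    x.caught <:+ y.caught := by
  unfold Board.step at h
  split at h
  · split at h <;> simp at h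
    subst h; exact List.suffix_rfl
  · cases h; exact List.suffix_rfl
  · split at h <;> cases h <;> first | exact List.suffix_rfl | exact List.suffix_cons _ _

theorem caught_suffix {M : TM n} {x y : Snap n} (h : Reaches M.board.step x y) :
    x.caught <:+ y.caught := by
  induction h with
  | refl => exact List.suffix_rfl
  | tail _ h ih => exact ih.trans (caught_suffix_of_step h)

/-- No ball can have come to rest unless it has been intercepted. -/
theorem caught_length_lt {M : TM n} {x y z : Snap n} (hx : x.motion = Motion.idle)
    (hxy : y ∈ M.board.step x) (hyz : Reaches M.board.step y z) (hz : z.motion = Motion.idle) :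
    x.caught.length < z.caught.length := by
  suffices x.caught.length ≤ z.caught.length ∧
      (z.motion = Motion.idle → x.caught.length < z.caught.length) from this.2 hz
  clear hz
  induction hyz with
  | refl =>
    refine ⟨(caught_suffix_of_step hxy).length_le, fun hy => ?_⟩
    unfold Board.step at hxy
    simp only [hx] at hxy
    split at hxy <;> cases hxy
    cases hy
  | @tail z z' _ h ih =>
    refine ⟨ih.1.trans (caught_suffix_of_step h).length_le, fun hz' => ?_⟩
    by_cases hz : z.motion = Motion.idle
    · exact (ih.2 hz).trans_le (caught_suffix_of_step h).length_le
    · unfold Board.step at h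
      split at h
      · contradiction
      · cases h; contradiction
      · split at h <;> cases h <;>
          first
          | exact Nat.lt_succ_of_le ih.1
          | (simp only [Board.leave] at hz'; split at hz' <;> cases hz')

theorem AfterBalls.eq {M : TM n} {w : List Bool} {m : ℕ} {x y : Snap n}
    (hx : AfterBalls M w m x) (hy : AfterBalls M w m y) : x = y := by
  obtain ⟨hx, hxi, hxm⟩ := hx
  obtain ⟨hy, hyi, hym⟩ := hy
  rcases reaches_total hx hy with h | h <;>
    obtain h | ⟨z, hz, h⟩ := Relation.ReflTransGen.cases_head h
  · exact h
  · exact absurd (caught_length_lt hxi hz h hyi) (by omega)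
  · exact h.symm
  · exact absurd (caught_length_lt hyi hz h hxi) (by omega)

/-- In a run with infinitely many different snapshots `X k`, every snapshot is followed by all but
finitely many of these. -/
theorem exists_reaches_of_injective {σ : Type*} {f : σ → Option σ} {X : ℕ → σ}
    (hX : Function.Injective X) {a c : σ} (h : ∀ k, Reaches f a (X k)) (hc : Reaches f a c) :
    ∃ K, ∀ k ≥ K, Reaches f c (X k) := by
  induction hc with
  | refl => exact ⟨0, fun k _ => h k⟩
  | @tail c c' _ hcc' ih =>
    obtain ⟨K, hK⟩ := ih
    have key : ∀ k ≥ K, c ≠ X k → Reaches f c' (X k) := fun k hk hne => by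
      obtain h | ⟨z, hz, h⟩ := Relation.ReflTransGen.cases_head (hK k hk)
      · exact absurd h hne
      · exact Option.mem_unique hz hcc' ▸ h
    by_cases hk : ∃ k, c = X k
    · obtain ⟨k, rfl⟩ := hk
      exact ⟨max K (k + 1), fun l hl => key l (by omega) fun h => by have := hX h; omega⟩
    · exact ⟨K, fun k hk' => key k hk' fun h => hk ⟨k, h⟩⟩

/-- Every snapshot that occurs in such a run has a successor, so the run does not stop. -/
theorem notMem_eval_of_injective {σ : Type*} {f : σ → Option σ} {X : ℕ → σ}
    (hX : Function.Injective X) {a : σ} (h : ∀ k, Reaches f a (X k)) (c : σ) : c ∉ eval f a := by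
  intro hc
  obtain ⟨K, hK⟩ := exists_reaches_of_injective hX h (mem_eval.mp hc).1
  have h₁ := (eval_maximal hc).mp (hK K le_rfl)
  have h₂ := (eval_maximal hc).mp (hK (K + 1) (by omega))
  exact absurd (hX (h₁.trans h₂.symm)) (by omega)

section

variable {c : TMCfg n} {m : Motion (Site n)} {P : List Hopper} {C : List (Site n)}

theorem valid_bits : Snapshot.Valid ⟨c.bits, m, P, C⟩ :=
  ⟨rfl, c.head, by simp [Snapshot.shows, Row.chain, TMCfg.bits],
    fun k hk => by simpa [Snapshot.shows, Row.chain, TMCfg.bits] using hk⟩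

theorem showsState_bits : Snapshot.ShowsState ⟨c.bits, m, P, C⟩ c.state := fun _ _ => rfl

theorem showsWord_bits {w : List Bool} :
    Snapshot.ShowsWord ⟨c.bits, m, P, C⟩ w ↔ c.tape = wordTape w := funext_iff.symm

theorem not_haltBall {x : Snap n} (h : ∀ b, Site.halt b ∉ x.caught) : ¬ x.HaltBall := by
  rintro ⟨b, l, hl⟩
  exact h b (by simp [hl])

end

/-! ### The three kinds of runs -/

/-- Once the machine has halted, a query ball and a symbol ball are still released; the latter
finds the halt state. -/
theorem exists_stopsWith {M : TM n} {w : List Bool} {t : ℕ} {c : TMCfg n}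
    (h : M.run w t = some c) (hc : c.state = Fin.last n) :
    ∃ (b : Bool) (C : List (Site n)), C.length = 2 * t + 1 ∧
      StopsWith M w ⟨c.bits, Motion.idle, [], Site.halt b :: C⟩ := by
  obtain ⟨C, hl, -, ho⟩ := exists_occurs h
  exact ⟨_, _, by simp [hl], mem_eval.mpr
    ⟨(ho.trans (reaches_query M c C)).trans (leads_halt M c _ hc).reaches_halt, rfl⟩⟩

theorem exists_afterBalls_of_runsForever {M : TM n} {w : List Bool} (h : M.RunsForever w) (m : ℕ) :
    ∃ x, AfterBalls M w m x ∧
      (∀ b, x.shows (Row.Q b (Fin.last n)) = false) ∧ ¬ x.HaltBall ∧ x.Valid := by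
  obtain ⟨c, hc⟩ := Option.isSome_iff_exists.mp (h (m / 2))
  have hs : c.state ≠ Fin.last n := fun hs => by
    have := h (m / 2 + 1)
    simp [TM.run, hc, TM.step_of_state hs] at this
  obtain ⟨C, hl, hn, ho⟩ := exists_occurs hc
  rcases Nat.mod_two_eq_zero_or_one m with hm | hm
  · exact ⟨_, ⟨ho, rfl, hl.trans (by omega)⟩, fun _ => decide_eq_false hs.symm,
      not_haltBall hn, valid_bits⟩
  · exact ⟨_, ⟨ho.trans (reaches_query M c C), rfl, by simp only [List.length_cons]; omega⟩,
      fun _ => decide_eq_false hs.symm, not_haltBall (by simpa using hn), valid_bits⟩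

theorem not_stopsWith_of_runsForever {M : TM n} {w : List Bool} (h : M.RunsForever w) (c : Snap n) :
    ¬ StopsWith M w c := by
  choose X hX using fun m => (exists_afterBalls_of_runsForever h m).imp fun _ => And.left
  exact notMem_eval_of_injective
    (fun k l hkl => by rw [← (hX k).2.2, ← (hX l).2.2, hkl]) (fun k => (hX k).1) c

/-- After a move off the left edge, no `h` bit is set, so the query ball runs past all 3-cells. -/
theorem exists_occurs_of_fallsOffAfter {M : TM n} {w : List Bool} {t : ℕ}
    (h : M.FallsOffAfter w t) :
    ∃ (f : Chain n → Bool) (C : List (Site n)) (d : ℕ → Side), C.length = 2 * t + 2 ∧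
      (∀ b, Site.halt b ∉ C) ∧ f Chain.edge = true ∧ (∀ k, f (Chain.head k) = false) ∧
      Occurs M w ⟨f, Motion.idle, [Hopper.query], C⟩ ∧
      ∀ k, Occurs M w
        ⟨f, Motion.entering (Site.part (Gadget.busH k Line.query) Slot.top) (d k), [], C⟩ := by
  obtain ⟨c, j, b, hc, h0, hi⟩ := h
  obtain ⟨i, hs, hd⟩ := TM.instr_eq_some hi
  obtain ⟨C, hl, hn, ho⟩ := exists_occurs hc
  have ho' := (ho.trans (reaches_query M c C)).trans
    ((leads_column hs hd).trans (leads_crash M { c with state := j } b h0)).reaches_trig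
  choose d hd using fun k =>
    (leads_bus (M := M) (f := crashBits j (Function.update c.tape c.head b)) Line.query (k := k)
      fun _ _ => rfl).reaches_entering (a := Hopper.query) (C := _ :: _ :: C) []
  exact ⟨_, _, d, by simp [hl], by simpa using hn, rfl, fun _ => rfl, ho',
    fun k => ho'.trans (hd k)⟩

end TTumble

theorem corollary5p5 (n : ℕ) (M : TTumble.TM n) (w : List Bool) :
    -- the structure computes exactly what the machine computes
    (∀ w' : List Bool,
      (∃ c, TTumble.StopsWith M w c ∧ c.HaltBall ∧ c.ShowsState (Fin.last n) ∧ c.ShowsWord w') ↔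
        ∃ t, M.HaltsIn w t w') ∧
    -- the machine halts after `t` steps with output `w'`
    (∀ (t : ℕ) (w' : List Bool), M.HaltsIn w t w' →
      (∃ c, TTumble.AfterBalls M w (2 * t) c ∧
        c.ShowsState (Fin.last n) ∧ c.ShowsWord w' ∧ c.Valid) ∧
      (∃ c, TTumble.StopsWith M w c ∧ c.caught.length = 2 * t + 2 ∧ c.HaltBall ∧
        c.ShowsState (Fin.last n) ∧ c.ShowsWord w' ∧ c.Valid)) ∧
    -- the machine runs forever
    (M.RunsForever w →
      (∀ c, ¬ TTumble.StopsWith M w c) ∧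
      (∀ m, ∃ c, TTumble.AfterBalls M w m c) ∧
      (∀ m c, TTumble.AfterBalls M w m c →
        (∀ b, c.shows (TTumble.Row.Q b (Fin.last n)) = false) ∧ ¬ c.HaltBall ∧ c.Valid)) ∧
    -- the machine moves off the left edge in its step number `t + 1`
    (∀ t : ℕ, M.FallsOffAfter w t →
      (∃ c, TTumble.AfterBalls M w (2 * t + 2) c ∧ c.Invalid) ∧
      (∀ c, ¬ TTumble.StopsWith M w c) ∧
      (∀ m c, TTumble.AfterBalls M w m c → m ≤ 2 * t + 2 ∧ ¬ c.HaltBall) ∧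
      (∀ D : ℕ, ∃ c s d, TTumble.Occurs M w c ∧ c.caught.length = 2 * t + 2 ∧
        c.motion = TTumble.Motion.entering s d ∧ D ≤ M.board.depth s)) := by
  open TTumble in
  have hhalts : ∀ (t : ℕ) (w' : List Bool), M.HaltsIn w t w' →
      (∃ c, AfterBalls M w (2 * t) c ∧ c.ShowsState (Fin.last n) ∧ c.ShowsWord w' ∧ c.Valid) ∧
      (∃ c, StopsWith M w c ∧ c.caught.length = 2 * t + 2 ∧ c.HaltBall ∧
        c.ShowsState (Fin.last n) ∧ c.ShowsWord w' ∧ c.Valid) := by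
    rintro t w' ⟨c, hc, hs, hw⟩
    constructor
    · obtain ⟨C, hl, -, ho⟩ := exists_occurs hc
      exact ⟨_, ⟨ho, rfl, hl⟩, hs ▸ showsState_bits, showsWord_bits.mpr hw, valid_bits⟩
    · obtain ⟨b, C, hl, hev⟩ := exists_stopsWith hc hs
      exact ⟨_, hev, by simp [hl], ⟨b, C, rfl⟩, hs ▸ showsState_bits, showsWord_bits.mpr hw,
        valid_bits⟩
  open TTumble in
  have hfalls : ∀ t : ℕ, M.FallsOffAfter w t →
      (∃ c, AfterBalls M w (2 * t + 2) c ∧ c.Invalid) ∧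
      (∀ c, ¬ StopsWith M w c) ∧
      (∀ m c, AfterBalls M w m c → m ≤ 2 * t + 2 ∧ ¬ c.HaltBall) ∧
      (∀ D : ℕ, ∃ c s d, Occurs M w c ∧ c.caught.length = 2 * t + 2 ∧
        c.motion = Motion.entering s d ∧ D ≤ M.board.depth s) := by
    intro t ht
    obtain ⟨f, C, d, hl, hn, he, hh, ho, hX⟩ := exists_occurs_of_fallsOffAfter ht
    have hinj : Function.Injective fun k => (⟨f, Motion.entering
        (Site.part (Gadget.busH k Line.query) Slot.top) (d k), [], C⟩ : Snap n) :=
      fun k l hkl => by simp at hkl; exact hkl.1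
    refine ⟨⟨_, ⟨ho, rfl, hl⟩, he, hh⟩, notMem_eval_of_injective hinj hX, ?_, fun D =>
      ⟨_, _, _, hX D, hl, rfl, ?_⟩⟩
    · rintro m c ⟨hc, -, rfl⟩
      obtain ⟨K, hK⟩ := exists_reaches_of_injective hinj hX hc
      have hsuf := caught_suffix (hK K le_rfl)
      exact ⟨hl ▸ hsuf.length_le, not_haltBall fun b hb => hn b (hsuf.subset hb)⟩
    · simp only [TM.board, Site.level, Gadget.level]
      omega
  refine ⟨fun w' => ⟨?_, fun ⟨t, ht⟩ => ?_⟩, hhalts, fun h => ⟨?_, ?_, ?_⟩, hfalls⟩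
  · rintro ⟨x, hx, -, -, hw⟩
    rcases M.runsForever_or w with h | ⟨t, c, hc, hs⟩ | ⟨t, ht⟩
    · exact absurd hx (TTumble.not_stopsWith_of_runsForever h x)
    · obtain ⟨b, C, -, hev⟩ := TTumble.exists_stopsWith hc hs
      rw [Part.mem_unique hx hev] at hw
      exact ⟨t, c, hc, hs, TTumble.showsWord_bits.mp hw⟩
    · exact absurd hx ((hfalls t ht).2.1 x)
  · obtain ⟨c, h₁, -, h₂, h₃, h₄, -⟩ := (hhalts t w' ht).2
    exact ⟨c, h₁, h₂, h₃, h₄⟩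
  · exact TTumble.not_stopsWith_of_runsForever h
  · exact fun m => (TTumble.exists_afterBalls_of_runsForever h m).imp fun _ => And.left
  · intro m c hc
    obtain ⟨x, hx, hgood⟩ := TTumble.exists_afterBalls_of_runsForever h m
    exact hc.eq hx ▸ hgood
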